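/- **Theorem 11.5.** For every real $\varepsilon\ge 0$, $\mathsf{PC}_{\mathbb R}\equiv_{\mathrm W}\mathsf P_{>\varepsilon}\mathsf C_{\mathbb R}$. Here $\mathcal A_-(\mathbb R)$ is the set of closed subsets of $\mathbb R$, where $A$ is represented by negative information: a name of $A$ is a sequence $p\in\mathbb N^{\mathbb N}$ of indices, in a standard enumeration $(B_n)_n$ of the open balls with rational centre and rational radius (including the empty ball), such that $A=\mathbb R\setminus\bigcup_i B_{p(i)}$. Real numbers are represented by the Cauchy representation: a name of $x$ is a sequence of codes of rationals $q_0,q_1,\dots$ with $|q_i-q_j|\le 2^{-i}$ for $i<j$ and $\lim_i q_i=x$. With $\lambda$ the Lebesgue measure on $\mathbb R$, $\mathsf P_{>\varepsilon}\mathsf C_{\mathbb R}:\subseteq\mathcal A_-(\mathbb R)\rightrightarrows\mathbb R$, $A\mapsto A$, is the multi-valued function with domain $\{A:\lambda(A)>\varepsilon\}$ (the case $\lambda(A)=\infty$ included) that sends $A$ to an arbitrary point of $A$, and $\mathsf{PC}_{\mathbb R}:=\mathsf P_{>0}\mathsf C_{\mathbb R}$. For multi-valued functions $f,g$ on represented spaces,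 a partial function $F:\subseteq\mathbb N^{\mathbb N}\to\mathbb N^{\mathbb N}$ realizes $f$, written $F\vdash f$, if for every name $p$ of a point $x\in\operatorname{dom}(f)$, $F(p)$ is defined and is a name of a point of $f(x)$. Then $f\le_{\mathrm W}g$ means that there are computable partial functions $K,H:\subseteq\mathbb N^{\mathbb N}\to\mathbb N^{\mathbb N}$ such that $p\mapsto H\langle p,G(K(p))\rangle$ realizes $f$ for every $G\vdash g$ (where $\langle p,q\rangle$ is the sequence $p(0),q(0),p(1),q(1),\dots$), and $f\equiv_{\mathrm W}g$ means $f\le_{\mathrm W}g$ and $g\le_{\mathrm W}f$. -/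

import Mathlib

open MeasureTheory Filter Topology
open scoped ENNReal

namespace Weihrauch

/-- Baire space `ℕ^ℕ`. -/
abbrev Baire : Type := ℕ → ℕ

/-- The prefix of length `k` of `p`. -/
def initSeg (p : Baire) (k : ℕ) : List ℕ := (List.range k).map p

/-- The pairing `⟨p, q⟩` of Baire space: `p` on even positions, `q` on odd positions. -/
def pairing (p q : Baire) : Baire := fun n => if n % 2 = 0 then p (n / 2) else q (n / 2)

/-- Computability of a partial function `F :⊆ ℕ^ℕ → ℕ^ℕ`: an algorithm `φ` computes, on the domain
of `F`, each output symbol from a finite prefix of the input. On input a prefix `w` and a position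
`n` it either returns the `n`-th output symbol or `none` (not yet known); its answers on the
prefixes of an input in the domain of `F` are correct, and for each `n` some prefix suffices.
As usual for reducibilities, restrictions of computable functions count as computable. -/
def BaireComputable (F : Baire →. Baire) : Prop :=
  ∃ φ : List ℕ → ℕ → Option ℕ, Computable₂ φ ∧
    ∀ p q, q ∈ F p → ∀ n,
      (∃ k, φ (initSeg p k) n = some (q n)) ∧
        ∀ k m, φ (initSeg p k) n = some m → m = q n

/-- A representation of `X`: a surjective partial map `δ :⊆ ℕ^ℕ → X`, given by its graph;
`δ.IsName p x` says that `p ∈ dom δ` and `δ p = x`. -/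
structure Representation (X : Type*) where
  IsName : Baire → X → Prop
  unique : ∀ p x y, IsName p x → IsName p y → x = y
  surj : ∀ x, ∃ p, IsName p x

/-- A partial multi-valued function `f :⊆ X ⇉ Y`. -/
structure MultiFun (X Y : Type*) where
  dom : Set X
  val : X → Set Y

/-- A multi-valued function on represented spaces. -/
structure Problem (X Y : Type*) extends MultiFun X Y where
  repIn : Representation X
  repOut : Representation Y

/-- `F ⊢ f`: on every name `p` of a point `x` of `dom f`, `F p` is defined and is a name of a
point of `f x`. -/
def IsRealizer {X Y : Type*} (F : Baire →. Baire) (f : Problem X Y) : Prop :=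
  ∀ p x, f.repIn.IsName p x → x ∈ f.dom →
    ∃ q ∈ F p, ∃ y, f.repOut.IsName q y ∧ y ∈ f.val x

/-- The partial function `H ⟨id, G K⟩`, with its natural domain. -/
def sandwich (H G K : Baire →. Baire) : Baire →. Baire := fun p =>
  (K p).bind fun r => (G r).bind fun q => H (pairing p q)

/-- Weihrauch reducibility `f ≤_W g`. -/
def Reducible {X Y Z W : Type*} (f : Problem X Y) (g : Problem Z W) : Prop :=
  ∃ K H : Baire →. Baire, BaireComputable K ∧ BaireComputable H ∧
    ∀ G : Baire →. Baire, IsRealizer G g → IsRealizer (sandwich H G K) f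

/-- Weihrauch equivalence `f ≡_W g`. -/
def Equivalent {X Y Z W : Type*} (f : Problem X Y) (g : Problem Z W) : Prop :=
  Reducible f g ∧ Reducible g f

section Metric

variable {X : Type*} [MetricSpace X]

/-- The Cauchy representation of a metric space with dense sequence `α`: a name of `x` is a
sequence of indices of points of the dense sequence that converges rapidly to `x`. -/
def cauchyRep (α : ℕ → X) (hα : DenseRange α) : Representation X where
  IsName p x := (∀ i j, i < j → dist (α (p i)) (α (p j)) ≤ (1 / 2 : ℝ) ^ i) ∧
    Tendsto (fun i => α (p i)) atTop (𝓝 x)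
  unique _ _ _ hx hy := tendsto_nhds_unique hx.2 hy.2
  surj x := by
    have h : ∀ i : ℕ, ∃ n, dist x (α n) < (1 / 2 : ℝ) ^ (i + 1) := fun i =>
      hα.exists_dist_lt x (by positivity)
    choose p hp using h
    refine ⟨p, fun i j hij => ?_, ?_⟩
    · have h1 : (1 / 2 : ℝ) ^ (j + 1) ≤ (1 / 2 : ℝ) ^ (i + 1) :=
        pow_le_pow_of_le_one (by norm_num) (by norm_num) (by omega)
      have h2 := dist_triangle_left (α (p i)) (α (p j)) x
      have h3 := hp i
      have h4 := hp j
      have h5 : (1 / 2 : ℝ) ^ (i + 1) = (1 / 2 : ℝ) ^ i / 2 := by rw [pow_succ]; ring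
      linarith
    · rw [tendsto_iff_dist_tendsto_zero]
      refine squeeze_zero (fun _ => dist_nonneg) (fun i => ?_)
        ((tendsto_add_atTop_iff_nat 1).2
          (tendsto_pow_atTop_nhds_zero_of_lt_one (r := (1 / 2 : ℝ)) (by norm_num) (by norm_num)))
      rw [dist_comm]
      exact (hp i).le

/-- The standard enumeration of the open balls with centre in the dense sequence and rational
radius: `⟨n, ⟨i, k⟩⟩` codes the ball around `α n` of radius `i / (k + 1)` (empty for `i = 0`). -/
def ratBall (α : ℕ → X) (c : ℕ) : Set X :=
  Metric.ball (α c.unpair.1) ((c.unpair.2.unpair.1 : ℝ) / ((c.unpair.2.unpair.2 : ℝ) + 1))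

/-- The space `𝒜₋(X)`, the closed subsets of `X` with respect to negative information: a name of
`A` is a list of open rational balls whose union is the complement of `A`. -/
def negRep (α : ℕ → X) (hα : DenseRange α) : Representation (TopologicalSpace.Closeds X) where
  IsName p A := (A : Set X) = (⋃ i, ratBall α (p i))ᶜ
  unique _ _ _ hA hB := TopologicalSpace.Closeds.ext (hA.trans hB.symm)
  surj A := by
    classical
    let z : ℕ := Nat.pair 0 (Nat.pair 0 0)
    have hz : ratBall α z = ∅ := by simp [ratBall, z]
    refine ⟨fun c => if ratBall α c ⊆ (A : Set X)ᶜ then c else z, ?_⟩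
    rw [eq_compl_comm]
    apply Set.Subset.antisymm
    · refine Set.iUnion_subset fun c => ?_
      dsimp only
      split_ifs with h
      · exact h
      · simp [hz]
    · intro x hx
      obtain ⟨r, hr, hball⟩ := Metric.isOpen_iff.1 A.isClosed.isOpen_compl x hx
      obtain ⟨k, hk⟩ := exists_nat_one_div_lt (half_pos hr)
      have hk0 : (0 : ℝ) < 1 / ((k : ℝ) + 1) := by positivity
      obtain ⟨n, hn⟩ := hα.exists_dist_lt x hk0
      have hb : ratBall α (Nat.pair n (Nat.pair 1 k)) = Metric.ball (α n) (1 / ((k : ℝ) + 1)) := by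
        simp [ratBall]
      have hsub : ratBall α (Nat.pair n (Nat.pair 1 k)) ⊆ (A : Set X)ᶜ := by
        rw [hb]
        refine Set.Subset.trans (fun y hy => ?_) hball
        have h2 := dist_triangle_right y x (α n)
        have h3 := Metric.mem_ball.1 hy
        exact Metric.mem_ball.2 (by linarith)
      refine Set.mem_iUnion.2 ⟨Nat.pair n (Nat.pair 1 k), ?_⟩
      dsimp only
      rw [if_pos hsub, hb]
      exact Metric.mem_ball.2 hn

/-- Probabilistic choice `P_I C_X`: given a closed set `A` with `μ A ∈ I` by negative information,
find a point of `A`. -/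
def probChoice [MeasurableSpace X] (α : ℕ → X) (hα : DenseRange α) (μ : Measure X)
    (I : Set ℝ≥0∞) : Problem (TopologicalSpace.Closeds X) X where
  dom := {A | μ (A : Set X) ∈ I}
  val := fun A => (A : Set X)
  repIn := negRep α hα
  repOut := cauchyRep α hα

end Metric

/-- The standard numbering `⟨⟨a, b⟩, c⟩ ↦ (a - b) / (c + 1)` of the rational numbers, as reals. -/
noncomputable def ratNum (n : ℕ) : ℝ :=
  ((n.unpair.1.unpair.1 : ℝ) - (n.unpair.1.unpair.2 : ℝ)) / ((n.unpair.2 : ℝ) + 1)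

theorem denseRange_ratNum : DenseRange ratNum := by
  refine Rat.denseRange_cast.mono ?_
  rintro _ ⟨q, rfl⟩
  refine ⟨Nat.pair (Nat.pair q.num.toNat (-q.num).toNat) (q.den - 1), ?_⟩
  have h1 : ((q.num.toNat : ℝ) - ((-q.num).toNat : ℝ)) = (q.num : ℝ) := by
    have := Int.toNat_sub_toNat_neg q.num
    exact_mod_cast this
  have h2 : ((q.den - 1 : ℕ) : ℝ) + 1 = (q.den : ℝ) := by
    have := q.pos
    have h : q.den - 1 + 1 = q.den := by omega
    exact_mod_cast h
  simp only [ratNum, Nat.unpair_pair]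
  rw [h1, h2]
  exact (Rat.cast_def q).symm

/-- `P_I C_ℝ`, with Lebesgue measure on `ℝ`. -/
noncomputable def realProbChoice (I : Set ℝ≥0∞) : Problem (TopologicalSpace.Closeds ℝ) ℝ :=
  probChoice ratNum denseRange_ratNum volume I

/-- `P_{>ε} C_ℝ`, i.e. `P_I C_ℝ` for `I = (ε, ∞]`. -/
noncomputable def realChoiceGT (ε : ℝ) : Problem (TopologicalSpace.Closeds ℝ) ℝ :=
  realProbChoice (Set.Ioi (ENNReal.ofReal ε))

/-- Positive choice `PC_ℝ`, i.e. `P_I C_ℝ` for `I = (0, ∞]`. -/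
noncomputable def realPositiveChoice : Problem (TopologicalSpace.Closeds ℝ) ℝ :=
  realProbChoice (Set.Ioi 0)

end Weihrauch

namespace Weihrauch

/-! A set of measure above `ε` has positive measure, so one direction is the identity on names
(`probChoice_reducible_of_subset`). For the other, the 1-Lipschitz map `zigzag` sweeps every bounded
interval infinitely often by isometric pieces. Hence the preimage of a closed set of positive
measure is closed of measure `∞`, above every `ε` (`volume_preimage_zigzag`), and `zigzag` sends a
point of the preimage back into the set. A name of the preimage is computed by a decidable test on
ball codes (`iUnion_ratBall_preimageSymbol`), and `zigzag` acts on rational codes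
(`ratNum_zigzagCode`). Both outer maps read one input symbol per output symbol, and the answer is
translated without the original name. -/

theorem initSeg_getElem? (p : Baire) (k i : ℕ) :
    (initSeg p k)[i]? = if i < k then some (p i) else none := by
  by_cases h : i < k <;> simp [initSeg, h]

/-- A function on Baire space is computable if each output symbol is computed from its position
and a single input symbol at a computable position. -/
theorem BaireComputable.of_pointwise {e : ℕ → ℕ} {g : ℕ → ℕ → ℕ} (he : Computable e)
    (hg : Computable₂ g) :
    BaireComputable (fun p => Part.some fun n => g n (p (e n))) := by
  refine ⟨fun w n => (w[e n]?).map (g n), ?_, ?_⟩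
  · exact Computable.option_map
      (Computable.list_getElem?.comp Computable.fst (he.comp Computable.snd))
      (hg.comp (Computable.snd.comp Computable.fst) Computable.snd)
  · intro p q hq n
    obtain rfl := Part.mem_some_iff.1 hq
    refine ⟨⟨e n + 1, by simp [initSeg_getElem?]⟩, fun k m hm => ?_⟩
    simp only [initSeg_getElem?] at hm
    split_ifs at hm
    · simpa using hm.symm
    · simp at hm

/-- The projection of a pair to its second component, followed by a computable map applied
symbol by symbol, is computable. -/
theorem BaireComputable.map_snd {g : ℕ → ℕ} (hg : Computable g) :
    BaireComputable (fun p => Part.some fun n => g (p (2 * n + 1))) :=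
  of_pointwise (g := fun _ m => g m)
    (Primrec.succ.comp (Primrec.nat_mul.comp (Primrec.const 2) Primrec.id)).to_comp
    (hg.comp Computable.snd)

theorem pairing_two_mul_add_one (p q : Baire) (n : ℕ) : pairing p q (2 * n + 1) = q n := by
  have h1 : (2 * n + 1) % 2 = 1 := by omega
  have h2 : (2 * n + 1) / 2 = n := by omega
  simp [pairing, h1, h2]

/-- Probabilistic choice is monotone in the set of admissible measures. -/
theorem probChoice_reducible_of_subset {X : Type*} [MetricSpace X] [MeasurableSpace X]
    (α : ℕ → X) (hα : DenseRange α) (μ : Measure X) {I J : Set ℝ≥0∞} (h : I ⊆ J) :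
    Reducible (probChoice α hα μ I) (probChoice α hα μ J) := by
  refine ⟨_, _, BaireComputable.of_pointwise (g := fun _ m => m) Computable.id Computable.snd,
    BaireComputable.map_snd Computable.id, fun G hG p A hp hA => ?_⟩
  obtain ⟨q, hq, x, hx, hxA⟩ := hG p A hp (h hA)
  refine ⟨q, ?_, x, hx, hxA⟩
  simp only [sandwich, Part.bind_some, Part.mem_bind_iff]
  exact ⟨q, hq, by simp [pairing_two_mul_add_one]⟩

/-! ### A zigzag map covering every bounded interval infinitely often -/

/-- The piecewise linear map `ℝ → ℝ` of slopes `±1` on `[0, ∞)` that goes from `(-1) ^ n * n` to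
`(-1) ^ (n + 1) * (n + 1)` on the interval `[n ^ 2, (n + 1) ^ 2]`, and vanishes on `(-∞, 0]`. -/
noncomputable def zigzag (x : ℝ) : ℝ :=
  (-1) ^ Nat.sqrt ⌊x⌋₊ * ((Nat.sqrt ⌊x⌋₊ : ℝ) ^ 2 + Nat.sqrt ⌊x⌋₊ - max x 0)

theorem zigzag_of_nonpos {x : ℝ} (hx : x ≤ 0) : zigzag x = 0 := by
  simp [zigzag, Nat.floor_of_nonpos hx, hx]

theorem zigzag_of_mem_Ico {n : ℕ} {x : ℝ} (h1 : (n : ℝ) ^ 2 ≤ x) (h2 : x < ((n : ℝ) + 1) ^ 2) :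
    zigzag x = (-1) ^ n * ((n : ℝ) ^ 2 + n - x) := by
  have hx : 0 ≤ x := le_trans (by positivity) h1
  have hs : n = Nat.sqrt ⌊x⌋₊ := by
    rw [Nat.eq_sqrt', Nat.le_floor_iff hx, Nat.floor_lt hx]
    exact ⟨by exact_mod_cast h1, by exact_mod_cast h2⟩
  rw [zigzag, ← hs, max_eq_left hx]

theorem zigzag_of_mem_Icc {n : ℕ} {x : ℝ} (h1 : (n : ℝ) ^ 2 ≤ x) (h2 : x ≤ ((n : ℝ) + 1) ^ 2) :
    zigzag x = (-1) ^ n * ((n : ℝ) ^ 2 + n - x) := by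
  rcases h2.lt_or_eq with h2 | rfl
  · exact zigzag_of_mem_Ico h1 h2
  -- The right endpoint belongs to the next piece; both formulas give `(-1) ^ (n + 1) * (n + 1)`
  -- there.
  · rw [zigzag_of_mem_Ico (n := n + 1) (by push_cast; rfl) (by push_cast; gcongr; linarith)]
    push_cast
    ring

theorem abs_neg_one_pow_mul (n : ℕ) (x : ℝ) : |(-1) ^ n * x| = |x| := by
  rw [abs_mul, abs_neg_one_pow, one_mul]

/-- Each piece has slope `±1`; an interval that crosses the breakpoint `n ^ 2` is split there. -/
theorem abs_zigzag_sub_le_of_le_sq (n : ℕ) :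
    ∀ x y : ℝ, x ≤ y → y ≤ (n : ℝ) ^ 2 → |zigzag x - zigzag y| ≤ y - x := by
  induction n with
  | zero =>
    intro x y hxy hy
    have hy : y ≤ 0 := by simpa using hy
    rw [zigzag_of_nonpos hy, zigzag_of_nonpos (hxy.trans hy)]
    simpa using hxy
  | succ n ih =>
    intro x y hxy hy
    push_cast at hy
    have piece : ∀ u, (n : ℝ) ^ 2 ≤ u → u ≤ y → |zigzag u - zigzag y| ≤ y - u := by
      intro u hu huy
      rw [zigzag_of_mem_Icc hu (huy.trans hy), zigzag_of_mem_Icc (hu.trans huy) hy, ← mul_sub,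
        abs_neg_one_pow_mul, abs_le]
      constructor <;> linarith
    rcases le_total y ((n : ℝ) ^ 2) with h | h
    · exact ih x y hxy h
    rcases le_total x ((n : ℝ) ^ 2) with h' | h'
    · have := abs_sub_le (zigzag x) (zigzag ((n : ℝ) ^ 2)) (zigzag y)
      linarith [ih x _ h' le_rfl, piece _ le_rfl h]
    · exact piece x h' hxy

/-- The constant 1 matters: ball radii and the rate `2 ^ (-i)` of Cauchy names carry over unchanged.
-/
theorem lipschitzWith_zigzag : LipschitzWith 1 zigzag := by
  have key : ∀ x y : ℝ, x ≤ y → |zigzag x - zigzag y| ≤ y - x := by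
    intro x y hxy
    -- The bound by 1 ensures `n ≤ n ^ 2`.
    obtain ⟨n, hn⟩ := exists_nat_ge (max y 1)
    have h1 : (1 : ℝ) ≤ n := (le_max_right _ _).trans hn
    exact abs_zigzag_sub_le_of_le_sq n x y hxy
      (((le_max_left _ _).trans hn).trans (le_self_pow₀ h1 two_ne_zero))
  refine LipschitzWith.of_dist_le_mul fun x y => ?_
  rw [NNReal.coe_one, one_mul, Real.dist_eq, Real.dist_eq]
  rcases le_total x y with h | h
  · exact (key x y h).trans ((neg_sub x y).symm.le.trans (neg_le_abs _))
  · rw [abs_sub_comm]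
    exact (key y x h).trans (le_abs_self _)

theorem measurePreserving_neg_one_pow_mul_sub (n : ℕ) (c : ℝ) :
    MeasurePreserving (fun x : ℝ => (-1) ^ n * (c - x)) volume volume := by
  have h := Measure.measurePreserving_sub_left (volume : Measure ℝ) c
  rcases Nat.even_or_odd n with hn | hn
  · simpa [hn.neg_one_pow] using h
  · simpa [hn.neg_one_pow, Function.comp_def] using
      (Measure.measurePreserving_neg (volume : Measure ℝ)).comp h

/-- Some bounded part `S N` of `A` has positive measure, and each piece with index `n ≥ N`
contributes a disjoint copy `T n` of at least that measure. -/
theorem volume_preimage_zigzag {A : Set ℝ} (hA : MeasurableSet A) (h : volume A ≠ 0) :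
    volume (zigzag ⁻¹' A) = ⊤ := by
  let S : ℕ → Set ℝ := fun n => A ∩ Set.Icc (-(n : ℝ)) n
  have hSm : ∀ n, MeasurableSet (S n) := fun n => hA.inter measurableSet_Icc
  have hSmono : Monotone S := fun m n hmn => by
    have : (m : ℝ) ≤ n := by exact_mod_cast hmn
    exact Set.inter_subset_inter_right _ (Set.Icc_subset_Icc (by linarith) this)
  have hSU : ⋃ n, S n = A := by
    rw [← Set.inter_iUnion, Set.inter_eq_left]
    intro x _
    obtain ⟨n, hn⟩ := exists_nat_ge |x|
    exact Set.mem_iUnion.2 ⟨n, abs_le.1 hn⟩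
  obtain ⟨N, hN⟩ : ∃ N, volume (S N) ≠ 0 := by
    by_contra! hS
    exact h (hSU ▸ measure_iUnion_null hS)
  let T : ℕ → Set ℝ := fun n => (fun x : ℝ => (-1) ^ n * (((n : ℝ) ^ 2 + n) - x)) ⁻¹' S n
  have hTm : ∀ n, MeasurableSet (T n) := fun n =>
    (measurePreserving_neg_one_pow_mul_sub n _).measurable (hSm n)
  have hTv : ∀ n, volume (T n) = volume (S n) := fun n =>
    (measurePreserving_neg_one_pow_mul_sub n _).measure_preimage (hSm n).nullMeasurableSet
  have hT : ∀ n, ∀ x ∈ T n, (n : ℝ) ^ 2 ≤ x ∧ x < ((n : ℝ) + 1) ^ 2 := by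
    intro n x hx
    -- From `|n ^ 2 + n - x| ≤ n` follows `n ^ 2 ≤ x ≤ n ^ 2 + 2 * n`, strictly below the next
    -- square.
    have h1 := abs_le.2 hx.2
    rw [abs_neg_one_pow_mul, abs_le] at h1
    constructor <;> nlinarith
  have hTd : Pairwise (Function.onFun Disjoint T) := by
    refine (pairwise_disjoint_on T).2 fun m n hmn => Set.disjoint_left.2 fun x hx hx' => ?_
    have h1 : (m : ℝ) + 1 ≤ n := by exact_mod_cast hmn
    have h2 : ((m : ℝ) + 1) ^ 2 ≤ (n : ℝ) ^ 2 := by gcongr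
    linarith [(hT m x hx).2, (hT n x hx').1]
  have hTsub : ⋃ n, T n ⊆ zigzag ⁻¹' A := by
    refine Set.iUnion_subset fun n x hx => ?_
    rw [Set.mem_preimage, zigzag_of_mem_Ico (hT n x hx).1 (hT n x hx).2]
    exact hx.1
  refine top_unique ?_
  calc ⊤ = ∑' _ : ℕ, volume (S N) := (ENNReal.tsum_const_eq_top_of_ne_zero hN).symm
    _ ≤ ∑' n : ℕ, volume (T (n + N)) :=
      ENNReal.tsum_le_tsum fun n => by
        rw [hTv]; exact measure_mono (hSmono (Nat.le_add_left N n))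
    _ = volume (⋃ n, T (n + N)) :=
      (measure_iUnion (f := fun n => T (n + N)) (fun m n hmn => hTd (by simpa using hmn))
        fun n => hTm _).symm
    _ ≤ volume (zigzag ⁻¹' A) :=
      measure_mono ((Set.iUnion_subset fun n => Set.subset_iUnion T (n + N)).trans hTsub)

/-! ### The zigzag map on codes of rational numbers -/

/-- The zigzag map on codes of rational numbers. -/
def zigzagCode (n : ℕ) : ℕ :=
  let d := n.unpair.2 + 1
  let m := n.unpair.1.unpair.1 - n.unpair.1.unpair.2
  let s := Nat.sqrt (m / d)
  Nat.pair (if s % 2 = 0 then Nat.pair ((s * s + s) * d) m else Nat.pair m ((s * s + s) * d))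
    n.unpair.2

theorem ratNum_zigzagCode (n : ℕ) : ratNum (zigzagCode n) = zigzag (ratNum n) := by
  obtain ⟨a, b, c, rfl⟩ : ∃ a b c, n = Nat.pair (Nat.pair a b) c :=
    ⟨n.unpair.1.unpair.1, n.unpair.1.unpair.2, n.unpair.2, by simp⟩
  have hd : (0 : ℝ) < (c : ℝ) + 1 := by positivity
  -- Truncated subtraction of numerators is exactly the cut-off at 0 in `zigzag`.
  have hmax : max (((a : ℝ) - b) / (c + 1)) 0 = ((a - b : ℕ) : ℝ) / ((c + 1 : ℕ) : ℝ) := by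
    push_cast
    rcases le_total b a with h | h
    · have h' : (b : ℝ) ≤ a := by exact_mod_cast h
      rw [Nat.cast_sub h, max_eq_left (div_nonneg (sub_nonneg.2 h') hd.le)]
    · have h' : (a : ℝ) ≤ b := by exact_mod_cast h
      rw [Nat.sub_eq_zero_of_le h, max_eq_right (div_nonpos_of_nonpos_of_nonneg
        (sub_nonpos.2 h') hd.le)]
      simp
  have hfloor : ⌊((a : ℝ) - b) / (c + 1)⌋₊ = (a - b) / (c + 1) := by
    rw [← Nat.floor_div_eq_div (K := ℝ), ← hmax]
    rcases le_total (((a : ℝ) - b) / (c + 1)) 0 with h | h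
    · rw [max_eq_right h, Nat.floor_of_nonpos h, Nat.floor_zero]
    · rw [max_eq_left h]
  have hx : ratNum (Nat.pair (Nat.pair a b) c) = ((a : ℝ) - b) / (c + 1) := by simp [ratNum]
  rw [hx, zigzag, hfloor, hmax]
  simp only [zigzagCode, Nat.unpair_pair]
  generalize Nat.sqrt ((a - b) / (c + 1)) = s
  -- The sign is realized by exchanging the two parts of the numerator when `s` is odd.
  rcases Nat.even_or_odd s with hs | hs
  · rw [hs.neg_one_pow, if_pos (Nat.even_iff.1 hs)]
    simp only [ratNum, Nat.unpair_pair]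
    push_cast
    field_simp
  · rw [hs.neg_one_pow, if_neg (by rw [Nat.odd_iff.1 hs]; decide)]
    simp only [ratNum, Nat.unpair_pair]
    push_cast
    field_simp
    ring

theorem primrec_unpair_fst : Primrec fun n : ℕ => n.unpair.1 := Primrec.fst.comp Primrec.unpair

theorem primrec_unpair_snd : Primrec fun n : ℕ => n.unpair.2 := Primrec.snd.comp Primrec.unpair

theorem primrec_zigzagCode : Primrec zigzagCode := by
  have hc := primrec_unpair_snd
  have hd := Primrec.succ.comp hc
  have hm := Primrec.nat_sub.comp (primrec_unpair_fst.comp primrec_unpair_fst)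
    (primrec_unpair_snd.comp primrec_unpair_fst)
  have hs := Primrec.nat_sqrt.comp (Primrec.nat_div.comp hm hd)
  have ht := Primrec.nat_mul.comp (Primrec.nat_add.comp (Primrec.nat_mul.comp hs hs) hs) hd
  exact Primrec₂.natPair.comp (Primrec.ite
    (Primrec.eq.comp (Primrec.nat_mod.comp hs (Primrec.const 2)) (Primrec.const 0))
    (Primrec₂.natPair.comp ht hm) (Primrec₂.natPair.comp hm ht)) hc

/-! ### Formal inclusion of rational balls -/

/-- The inequality `(a₁ - b₁) / d₁ + i₁ / e₁ ≤ (a₂ - b₂) / d₂ + i₂ / e₂` between fractions of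
natural numbers, with cleared denominators. -/
def fracLe (a₁ b₁ d₁ i₁ e₁ a₂ b₂ d₂ i₂ e₂ : ℕ) : Prop :=
  (a₁ * d₂ + b₂ * d₁) * (e₁ * e₂) + i₁ * e₂ * (d₁ * d₂) ≤
    (a₂ * d₁ + b₁ * d₂) * (e₁ * e₂) + i₂ * e₁ * (d₁ * d₂)

instance (a₁ b₁ d₁ i₁ e₁ a₂ b₂ d₂ i₂ e₂ : ℕ) :
    Decidable (fracLe a₁ b₁ d₁ i₁ e₁ a₂ b₂ d₂ i₂ e₂) :=
  inferInstanceAs (Decidable (_ ≤ _))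

theorem fracLe_iff {a₁ b₁ d₁ i₁ e₁ a₂ b₂ d₂ i₂ e₂ : ℕ} (hd₁ : 0 < d₁) (he₁ : 0 < e₁)
    (hd₂ : 0 < d₂) (he₂ : 0 < e₂) :
    fracLe a₁ b₁ d₁ i₁ e₁ a₂ b₂ d₂ i₂ e₂ ↔
      ((a₁ : ℝ) - b₁) / d₁ + i₁ / e₁ ≤ ((a₂ : ℝ) - b₂) / d₂ + i₂ / e₂ := by
  have h1 : (0 : ℝ) < d₁ := by exact_mod_cast hd₁
  have h2 : (0 : ℝ) < d₂ := by exact_mod_cast hd₂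
  have h3 : (0 : ℝ) < e₁ := by exact_mod_cast he₁
  have h4 : (0 : ℝ) < e₂ := by exact_mod_cast he₂
  rw [fracLe, ← Nat.cast_le (α := ℝ), ← sub_nonneg, ← sub_nonneg (b := _ / _ + _ / _)]
  have key : ((a₂ : ℝ) - b₂) / d₂ + i₂ / e₂ - (((a₁ : ℝ) - b₁) / d₁ + i₁ / e₁) =
      ((((a₂ * d₁ + b₁ * d₂) * (e₁ * e₂) + i₂ * e₁ * (d₁ * d₂) : ℕ) : ℝ) -
        (((a₁ * d₂ + b₂ * d₁) * (e₁ * e₂) + i₁ * e₂ * (d₁ * d₂) : ℕ) : ℝ)) /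
      (d₁ * d₂ * (e₁ * e₂)) := by
    push_cast
    field_simp
    ring
  rw [key]
  exact ⟨fun h => div_nonneg h (by positivity), fun h => by
    simpa using (le_div_iff₀ (by positivity)).1 h⟩

theorem primrecPred_fracLe {γ : Type*} [Primcodable γ]
    {a₁ b₁ d₁ i₁ e₁ a₂ b₂ d₂ i₂ e₂ : γ → ℕ} (ha₁ : Primrec a₁) (hb₁ : Primrec b₁)
    (hd₁ : Primrec d₁) (hi₁ : Primrec i₁) (he₁ : Primrec e₁) (ha₂ : Primrec a₂)
    (hb₂ : Primrec b₂) (hd₂ : Primrec d₂) (hi₂ : Primrec i₂) (he₂ : Primrec e₂) :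
    PrimrecPred fun x =>
      fracLe (a₁ x) (b₁ x) (d₁ x) (i₁ x) (e₁ x) (a₂ x) (b₂ x) (d₂ x) (i₂ x) (e₂ x) := by
  have mul {u v : γ → ℕ} (hu : Primrec u) (hv : Primrec v) : Primrec fun x => u x * v x :=
    Primrec.nat_mul.comp hu hv
  have add {u v : γ → ℕ} (hu : Primrec u) (hv : Primrec v) : Primrec fun x => u x + v x :=
    Primrec.nat_add.comp hu hv
  exact Primrec.nat_le.comp
    (add (mul (add (mul ha₁ hd₂) (mul hb₂ hd₁)) (mul he₁ he₂))
      (mul (mul hi₁ he₂) (mul hd₁ hd₂)))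
    (add (mul (add (mul ha₂ hd₁) (mul hb₁ hd₂)) (mul he₁ he₂))
      (mul (mul hi₂ he₁) (mul hd₁ hd₂)))

/-- The radius of the rational ball with code `c`. -/
noncomputable def ballRadius (c : ℕ) : ℝ :=
  (c.unpair.2.unpair.1 : ℝ) / ((c.unpair.2.unpair.2 : ℝ) + 1)

/-- The ball with code `c` is formally contained in the preimage under the zigzag map of the ball
with code `b`: the ball of the same radius as `c` around the image of the centre of `c` is formally
contained in `b`. -/
def PreimageIncl (b c : ℕ) : Prop :=
  let x := zigzagCode c.unpair.1
  let y := b.unpair.1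
  fracLe x.unpair.1.unpair.1 x.unpair.1.unpair.2 (x.unpair.2 + 1) c.unpair.2.unpair.1
      (c.unpair.2.unpair.2 + 1) y.unpair.1.unpair.1 y.unpair.1.unpair.2 (y.unpair.2 + 1)
      b.unpair.2.unpair.1 (b.unpair.2.unpair.2 + 1) ∧
    fracLe x.unpair.1.unpair.2 x.unpair.1.unpair.1 (x.unpair.2 + 1) c.unpair.2.unpair.1
      (c.unpair.2.unpair.2 + 1) y.unpair.1.unpair.2 y.unpair.1.unpair.1 (y.unpair.2 + 1)
      b.unpair.2.unpair.1 (b.unpair.2.unpair.2 + 1)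

instance : DecidableRel PreimageIncl := fun _ _ => inferInstanceAs (Decidable (_ ∧ _))

/-- Exchanging the parts of a numerator negates a centre, so the two conjuncts bound the difference
of the centres from both sides, which bounds its absolute value. -/
theorem preimageIncl_iff {b c : ℕ} :
    PreimageIncl b c ↔
      dist (zigzag (ratNum c.unpair.1)) (ratNum b.unpair.1) + ballRadius c ≤ ballRadius b := by
  have hneg (n : ℕ) : ((n.unpair.1.unpair.2 : ℝ) - n.unpair.1.unpair.1) / (n.unpair.2 + 1) =
      -ratNum n := by rw [ratNum, ← neg_div, neg_sub]
  rw [PreimageIncl, fracLe_iff (Nat.succ_pos _) (Nat.succ_pos _) (Nat.succ_pos _) (Nat.succ_pos _),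
    fracLe_iff (Nat.succ_pos _) (Nat.succ_pos _) (Nat.succ_pos _) (Nat.succ_pos _),
    ← ratNum_zigzagCode, Real.dist_eq, ← le_sub_iff_add_le (a := |_|), abs_le]
  push_cast
  rw [hneg, hneg]
  simp only [← ratNum.eq_1, ← ballRadius.eq_1]
  constructor
  · rintro ⟨h1, h2⟩
    constructor <;> linarith
  · rintro ⟨h1, h2⟩
    constructor <;> linarith

theorem primrecRel_preimageIncl : PrimrecRel PreimageIncl := by
  have hx := primrec_zigzagCode.comp (primrec_unpair_fst.comp (Primrec.snd (α := ℕ) (β := ℕ)))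
  have hy := primrec_unpair_fst.comp (Primrec.fst (α := ℕ) (β := ℕ))
  have hcr := primrec_unpair_snd.comp (Primrec.snd (α := ℕ) (β := ℕ))
  have hbr := primrec_unpair_snd.comp (Primrec.fst (α := ℕ) (β := ℕ))
  have ha₁ := primrec_unpair_fst.comp (primrec_unpair_fst.comp hx)
  have hb₁ := primrec_unpair_snd.comp (primrec_unpair_fst.comp hx)
  have hd₁ := Primrec.succ.comp (primrec_unpair_snd.comp hx)
  have hi₁ := primrec_unpair_fst.comp hcr
  have he₁ := Primrec.succ.comp (primrec_unpair_snd.comp hcr)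
  have ha₂ := primrec_unpair_fst.comp (primrec_unpair_fst.comp hy)
  have hb₂ := primrec_unpair_snd.comp (primrec_unpair_fst.comp hy)
  have hd₂ := Primrec.succ.comp (primrec_unpair_snd.comp hy)
  have hi₂ := primrec_unpair_fst.comp hbr
  have he₂ := Primrec.succ.comp (primrec_unpair_snd.comp hbr)
  exact (primrecPred_fracLe ha₁ hb₁ hd₁ hi₁ he₁ ha₂ hb₂ hd₂ hi₂ he₂).and
    (primrecPred_fracLe hb₁ ha₁ hd₁ hi₁ he₁ hb₂ ha₂ hd₂ hi₂ he₂)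

/-- Code 0 is the padding symbol emitted when the inclusion test fails. -/
theorem ratBall_zero {X : Type*} [MetricSpace X] (α : ℕ → X) : ratBall α 0 = ∅ := by
  simp [ratBall]

theorem ratBall_subset_preimage_zigzag {b c : ℕ} (h : PreimageIncl b c) :
    ratBall ratNum c ⊆ zigzag ⁻¹' ratBall ratNum b := by
  intro x hx
  have h1 : dist x (ratNum c.unpair.1) < ballRadius c := hx
  have h2 := preimageIncl_iff.1 h
  have h3 := lipschitzWith_zigzag.dist_le_mul x (ratNum c.unpair.1)
  rw [NNReal.coe_one, one_mul] at h3
  have h4 := dist_triangle (zigzag x) (zigzag (ratNum c.unpair.1)) (ratNum b.unpair.1)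
  show dist (zigzag x) (ratNum b.unpair.1) < ballRadius b
  linarith

/-- Formal inclusion may be stricter than inclusion, but small enough balls near `x` pass the test,
so no point of the preimage is lost. -/
theorem exists_preimageIncl {b : ℕ} {x : ℝ} (hx : zigzag x ∈ ratBall ratNum b) :
    ∃ c, PreimageIncl b c ∧ x ∈ ratBall ratNum c := by
  have h1 : dist (zigzag x) (ratNum b.unpair.1) < ballRadius b := hx
  -- Half of the slack pays for moving the centre from `x` to `ratNum n`, half for the radius.
  obtain ⟨k, hk⟩ := exists_nat_one_div_lt (half_pos (sub_pos.2 h1))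
  obtain ⟨n, hn⟩ := denseRange_ratNum.exists_dist_lt x (ε := 1 / ((k : ℝ) + 1)) (by positivity)
  have hr : ballRadius (Nat.pair n (Nat.pair 1 k)) = 1 / ((k : ℝ) + 1) := by simp [ballRadius]
  refine ⟨Nat.pair n (Nat.pair 1 k), preimageIncl_iff.2 ?_, ?_⟩
  · rw [hr, Nat.unpair_pair]
    have h3 := lipschitzWith_zigzag.dist_le_mul x (ratNum n)
    rw [NNReal.coe_one, one_mul] at h3
    have h4 := dist_triangle_left (zigzag (ratNum n)) (ratNum b.unpair.1) (zigzag x)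
    simp only
    linarith
  · show dist x (ratNum (Nat.pair n (Nat.pair 1 k)).unpair.1) < ballRadius _
    rw [hr, Nat.unpair_pair]
    exact hn

/-! ### Names of preimages and the reduction through `zigzag` -/

/-- The symbol `n = ⟨i, c⟩` of a name of the preimage of a closed set under the zigzag map, where
`b` is the symbol `i` of a name of that set. -/
def preimageSymbol (n b : ℕ) : ℕ := if PreimageIncl b n.unpair.2 then n.unpair.2 else 0

theorem primrec₂_preimageSymbol : Primrec₂ preimageSymbol := by
  have hn := primrec_unpair_snd.comp (Primrec.fst (α := ℕ) (β := ℕ))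
  exact Primrec.ite (primrecRel_preimageIncl.comp Primrec.snd hn) hn (Primrec.const 0)

theorem iUnion_ratBall_preimageSymbol (p : Baire) :
    ⋃ n, ratBall ratNum (preimageSymbol n (p n.unpair.1)) =
      zigzag ⁻¹' ⋃ i, ratBall ratNum (p i) := by
  apply Set.Subset.antisymm
  · refine Set.iUnion_subset fun n => ?_
    rw [preimageSymbol]
    split_ifs with h
    · exact (ratBall_subset_preimage_zigzag h).trans
        (Set.preimage_mono (Set.subset_iUnion (fun i => ratBall ratNum (p i)) _))
    · simp [ratBall_zero]
  · intro x hx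
    obtain ⟨i, hi⟩ := Set.mem_iUnion.1 hx
    obtain ⟨c, hc, hxc⟩ := exists_preimageIncl hi
    refine Set.mem_iUnion.2 ⟨Nat.pair i c, ?_⟩
    simpa [preimageSymbol, hc] using hxc

theorem cauchyRep_isName_zigzagCode {q : Baire} {x : ℝ}
    (h : (cauchyRep ratNum denseRange_ratNum).IsName q x) :
    (cauchyRep ratNum denseRange_ratNum).IsName (fun n => zigzagCode (q n)) (zigzag x) := by
  refine ⟨fun i j hij => ?_, ?_⟩
  · have h3 := lipschitzWith_zigzag.dist_le_mul (ratNum (q i)) (ratNum (q j))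
    rw [NNReal.coe_one, one_mul] at h3
    simpa only [ratNum_zigzagCode] using h3.trans (h.1 i j hij)
  · simpa only [ratNum_zigzagCode, Function.comp_def] using
      (lipschitzWith_zigzag.continuous.tendsto x).comp h.2

/-- Closed choice for sets of positive measure reduces to closed choice for sets with
measure in `I`, provided that `I` contains `∞`. -/
theorem realProbChoice_Ioi_zero_reducible {I : Set ℝ≥0∞} (hI : ⊤ ∈ I) :
    Reducible (realProbChoice (Set.Ioi 0)) (realProbChoice I) := by
  refine ⟨_, _, BaireComputable.of_pointwise primrec_unpair_fst.to_comp
    primrec₂_preimageSymbol.to_comp, BaireComputable.map_snd primrec_zigzagCode.to_comp,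
    fun G hG p A hp hA => ?_⟩
  have hname : (A : Set ℝ) = (⋃ i, ratBall ratNum (p i))ᶜ := hp
  have hpos : 0 < volume (A : Set ℝ) := hA
  let B : TopologicalSpace.Closeds ℝ :=
    ⟨zigzag ⁻¹' A, A.isClosed.preimage lipschitzWith_zigzag.continuous⟩
  have hB : volume (B : Set ℝ) = ⊤ := volume_preimage_zigzag A.isClosed.measurableSet hpos.ne'
  obtain ⟨q, hq, x, hx, hxB⟩ := hG (fun n => preimageSymbol n (p n.unpair.1)) B
    (show zigzag ⁻¹' (A : Set ℝ) = _ by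
      rw [iUnion_ratBall_preimageSymbol, hname, Set.preimage_compl])
    (show volume (B : Set ℝ) ∈ I by rwa [hB])
  refine ⟨fun n => zigzagCode (q n), ?_, zigzag x, cauchyRep_isName_zigzagCode hx, hxB⟩
  simp only [sandwich, Part.bind_some, Part.mem_bind_iff]
  exact ⟨q, hq, by simp [pairing_two_mul_add_one]⟩

end Weihrauch

theorem theorem11p5 (ε : ℝ) (hε : 0 ≤ ε) :
    Weihrauch.Equivalent Weihrauch.realPositiveChoice (Weihrauch.realChoiceGT ε) :=
  -- As `ε` is finite, `∞` is an admissible measure.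
  ⟨Weihrauch.realProbChoice_Ioi_zero_reducible ENNReal.ofReal_lt_top,
    Weihrauch.probChoice_reducible_of_subset _ _ _ (Set.Ioi_subset_Ioi zero_le)⟩
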